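/- Let $D\ge 1$, let $\mathcal H$ be a real Hilbert space, $\lambda>0$, $0<p\le 1$, and let $a:\mathbb R^D\to\mathcal H$ be the atom function of a generalized Laplace dictionary with parameters $\lambda,p$, i.e. $$\langle a(\theta),a(\theta')\rangle=\exp\Big(-\lambda\sum_{d=1}^D|\theta[d]-\theta'[d]|^p\Big)\qquad\text{for all }\theta,\theta'\in\mathbb R^D .$$ *Orthogonal Matching Pursuit (OMP)* with input $y\in\mathcal H$ starts with the residual $r=y$ and no selected parameter. As long as $r\neq 0$, iteration $t=1,2,\dots$ selects a maximizer $\hat\theta_t$ of $\theta\mapsto|\langle a(\theta),r\rangle|$ over all of $\mathbb R^D$, computes least-squares coefficients $(\hat c_1,\dots,\hat c_t)\in\arg\min_{c\in\mathbb R^t}\|y-\sum_{i\le t}c_i\,a(\hat\theta_i)\|$, and updates $r=y-\sum_{i\le t}\hat c_i\,a(\hat\theta_i)$. When $r=0$ it stops and outputs the support $\{\hat\theta_1,\dots,\hat\theta_t\}$ and the coefficients $\hat c_1,\dots,\hat c_t$. For a finite set $S\subset\mathbb R^D$, OMP *achieves exact $\mathrm{card}(S)$-step recovery of $S$* if for every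 choice of nonzero real coefficients $(c_\theta)_{\theta\in S}$ and every possible run of OMP with input $y=\sum_{\theta\in S}c_\theta\,a(\theta)$ (whatever maximizers and least-squares coefficients are chosen): the run is never stuck (the required maximizers and minimizers exist), it stops after exactly $\mathrm{card}(S)$ iterations, its output support is $S$, and $\hat c_i=c_{\hat\theta_i}$ for all $i$. Let $S^\star=\{\theta^\star_1,\dots,\theta^\star_k\}\subset\mathbb R^D$ consist of $k\ge 1$ pairwise distinct points and put $$\Delta_0=\min_{1\le d\le D}\ \min\big\{|\theta^\star_\ell[d]-\theta^\star_{\ell'}[d]| : 1\le \ell,\ell'\le k,\ \theta^\star_\ell[d]\ne\theta^\star_{\ell'}[d]\big\},$$ where coordinates $d$ for which the inner set is empty are ignored (for $k=1$, where there is nothing to minimize, the condition below is regarded as satisfied). If $$\Delta_0^{\,p}\ \ge\ \frac{\log(2k-1)}{\lambda},$$ then OMP achieves exact $\mathrm{card}(S)$-step recovery of every $S\subseteq S^\star$. -/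

import Mathlib

open scoped RealInnerProductSpace

/-- Residual of the observation `y` after approximating it by the linear combination with
coefficients `c` of the atoms `a (θ 0), …, a (θ (t-1))`. -/
def ompResidual {Θ H : Type*} [NormedAddCommGroup H] [InnerProductSpace ℝ H]
    (a : Θ → H) (y : H) {t : ℕ} (θ : Fin t → Θ) (c : Fin t → ℝ) : H :=
  y - ∑ i, c i • a (θ i)

/-- `OMPReach a y t θ c`: some run of Orthogonal Matching Pursuit with atom function `a` and
observation `y` performs (at least) `t` iterations, has selected the parameters
`θ 0, …, θ (t-1)` in this order, and its least-squares coefficients after iteration `t` are `c`.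
An iteration is only performed if the current residual is nonzero; it selects any global maximizer
of `|⟪a ϑ, r⟫|` over the whole parameter space, appends it, and takes any least-squares
coefficients. All admissible choices are allowed, so the relation describes every possible run. -/
inductive OMPReach {Θ H : Type*} [NormedAddCommGroup H] [InnerProductSpace ℝ H]
    (a : Θ → H) (y : H) : (t : ℕ) → (Fin t → Θ) → (Fin t → ℝ) → Prop
  | init (θ : Fin 0 → Θ) (c : Fin 0 → ℝ) : OMPReach a y 0 θ c
  | step {t : ℕ} {θ : Fin t → Θ} {c : Fin t → ℝ} (h : OMPReach a y t θ c)
      (hr : ompResidual a y θ c ≠ 0)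
      (θnew : Θ)
      (hsel : ∀ ϑ : Θ, |⟪a ϑ, ompResidual a y θ c⟫| ≤ |⟪a θnew, ompResidual a y θ c⟫|)
      (c' : Fin (t + 1) → ℝ)
      (hls : ∀ d : Fin (t + 1) → ℝ,
        ‖ompResidual a y (Fin.snoc θ θnew : Fin (t + 1) → Θ) c'‖ ≤
          ‖ompResidual a y (Fin.snoc θ θnew : Fin (t + 1) → Θ) d‖) :
      OMPReach a y (t + 1) (Fin.snoc θ θnew : Fin (t + 1) → Θ) c'

/-- `(θ, c)` is a reachable output of OMP with input `y`, obtained after exactly `t` iterations: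
the state is reachable and the loop stops there since the residual is zero. -/
def OMPOutput {Θ H : Type*} [NormedAddCommGroup H] [InnerProductSpace ℝ H]
    (a : Θ → H) (y : H) (t : ℕ) (θ : Fin t → Θ) (c : Fin t → ℝ) : Prop :=
  OMPReach a y t θ c ∧ ompResidual a y θ c = 0

/-- OMP achieves exact `card S`-step recovery of `S`: for all choices of nonzero coefficients
`(c θ)` for `θ ∈ S`, with input `y = ∑ θ ∈ S, c θ • a θ`,
* OMP never gets stuck: as long as the residual is nonzero a maximizer and least-squares
  coefficients exist, so that a further iteration can be performed;
* no run performs more than `card S` iterations (so every run stops);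
* every reachable output is produced after exactly `card S` iterations, its support is `S`, and
  its coefficients are the ones that generated `y`. -/
def OMPExactRecovery {Θ H : Type*} [NormedAddCommGroup H] [InnerProductSpace ℝ H]
    (a : Θ → H) (S : Finset Θ) : Prop :=
  ∀ c : Θ → ℝ, (∀ θ ∈ S, c θ ≠ 0) →
    (∀ (t : ℕ) (θ : Fin t → Θ) (ĉ : Fin t → ℝ),
      OMPReach a (∑ ϑ ∈ S, c ϑ • a ϑ) t θ ĉ →
      ompResidual a (∑ ϑ ∈ S, c ϑ • a ϑ) θ ĉ ≠ 0 →
      ∃ (θnew : Θ) (c' : Fin (t + 1) → ℝ),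
        OMPReach a (∑ ϑ ∈ S, c ϑ • a ϑ) (t + 1) (Fin.snoc θ θnew : Fin (t + 1) → Θ) c') ∧
    (∀ (t : ℕ) (θ : Fin t → Θ) (ĉ : Fin t → ℝ),
      OMPReach a (∑ ϑ ∈ S, c ϑ • a ϑ) t θ ĉ → t ≤ S.card) ∧
    (∀ (t : ℕ) (θ : Fin t → Θ) (ĉ : Fin t → ℝ),
      OMPOutput a (∑ ϑ ∈ S, c ϑ • a ϑ) t θ ĉ →
      t = S.card ∧ Set.range θ = (S : Set Θ) ∧ ∀ i, ĉ i = c (θ i))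

/-- The atom function `a : ℝ^D → H` defines a generalized Laplace dictionary with parameters
`l > 0` and `0 < p ≤ 1`: its induced kernel is `exp (-l * ‖θ - θ'‖_p ^ p)`, where
`‖x‖_p ^ p = ∑ d, |x d| ^ p`. -/
structure IsGeneralizedLaplaceDictionary {D : ℕ} {H : Type*} [NormedAddCommGroup H]
    [InnerProductSpace ℝ H] (a : (Fin D → ℝ) → H) (l p : ℝ) : Prop where
  l_pos : 0 < l
  p_pos : 0 < p
  p_le_one : p ≤ 1
  inner_eq : ∀ θ θ' : Fin D → ℝ, ⟪a θ, a θ'⟫ = Real.exp (-l * ∑ d, |θ d - θ' d| ^ p)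

/-- The nonzero coordinatewise distances between the points of `S`. -/
def coordSeparations {D : ℕ} (S : Finset (Fin D → ℝ)) : Set ℝ :=
  {x | ∃ d : Fin D, ∃ θ ∈ S, ∃ θ' ∈ S, θ d ≠ θ' d ∧ x = |θ d - θ' d|}

/-- The minimal nonzero coordinatewise separation `Δ₀` of `S`. It is a minimum over a finite set,
nonempty as soon as `S` has two points. If `S` has only one point the set is empty and the value
is `0`; the bound `log (2 * 1 - 1) / l = 0` on `Δ₀ ^ p` then still holds for `p > 0`. -/
noncomputable def minCoordSeparation {D : ℕ} (S : Finset (Fin D → ℝ)) : ℝ :=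
  sInf (coordSeparations S)

/-! OMP recovers `S` as soon as every nonzero combination `f = ∑ c_s K(·, s)`, `s ∈ S`, attains its
maximal absolute value only on `S`. The residual then stays in the span of the atoms of `S`, every
selection lies in `S`, and orthogonality of least-squares residuals forbids repetitions
(`ompExactRecovery_of_forall_exists_lt`).

To prove this maximum principle, write `μ = exp (-l r^p)`, so that `(2n - 1) μ ≤ 1` for `n = card
S`. The kernel is a product over coordinates, so along a coordinate line `f` is a combination of
translates of the profile `exp (-l t^p)`. A point off the nodes is compared with its neighbouring
nodes: `f x` is a nonnegative combination of node values with total weight `1 - η`, up to errors at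
most `η μ / (1 - μ)` per coefficient, with no error at one node. Together with diagonal dominance
this makes `|f|` strictly larger at some node (`IsConvexProfile.exists_node_abs_lt`). Moving one
coordinate at a time thus leads to the grid spanned by the coordinates of `S`. At grid points
outside `S`, a coherence estimate involving `2n - 1` kernel values decides; it is strict because
three distinct grid points cannot all be at minimal distance (`exists_abs_lt_of_mem_grid`). -/

/-! ### Convex profiles on the half-line -/

/-- Radial profiles `φ` of kernels `φ |x - y|` on the line: decreasing, convex and
supermultiplicative functions on the half-line with `φ 0 = 1`. -/
structure IsConvexProfile (φ : ℝ → ℝ) : Prop where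
  zero : φ 0 = 1
  pos : ∀ t, 0 < φ t
  anti : StrictAntiOn φ (Set.Ici 0)
  convex : ConvexOn ℝ (Set.Ici 0) φ
  mul_le : ∀ s t, 0 ≤ s → 0 ≤ t → φ s * φ t ≤ φ (s + t)

namespace IsConvexProfile

/-- For `p ≤ 1` the power `t ^ p` is concave and subadditive; composing its negative multiple with
`exp` turns this into convexity and supermultiplicativity. -/
theorem exp_rpow {l p : ℝ} (hl : 0 < l) (hp : 0 < p) (hp1 : p ≤ 1) :
    IsConvexProfile fun t => Real.exp (-l * t ^ p) where
  zero := by simp [Real.zero_rpow hp.ne']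
  pos t := Real.exp_pos _
  anti := by
    intro s hs t _ hst
    have := Real.rpow_lt_rpow hs hst hp
    exact Real.exp_lt_exp.2 (by nlinarith)
  convex := by
    refine ⟨convex_Ici 0, fun x hx y hy a b ha hb hab => ?_⟩
    have h1 := (Real.concaveOn_rpow hp.le hp1).2 hx hy ha hb hab
    have h2 := convexOn_exp.2 (Set.mem_univ (-l * x ^ p)) (Set.mem_univ (-l * y ^ p)) ha hb hab
    simp only [smul_eq_mul] at *
    refine le_trans (Real.exp_le_exp.2 ?_) h2
    nlinarith
  mul_le s t hs ht := by
    rw [← Real.exp_add]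
    have := Real.rpow_add_le_add_rpow hs ht hp.le hp1
    exact Real.exp_le_exp.2 (by nlinarith)

variable {φ : ℝ → ℝ}

theorem lt_one (h : IsConvexProfile φ) {t : ℝ} (ht : 0 < t) : φ t < 1 := by
  have := h.anti Set.self_mem_Ici ht.le ht
  rwa [h.zero] at this

theorem le_of_le (h : IsConvexProfile φ) {s t : ℝ} (hs : 0 ≤ s) (hst : s ≤ t) : φ t ≤ φ s :=
  h.anti.antitoneOn hs (hs.trans hst) hst

/-- A convex function lies below its chord over `[t, t + s + d]`. -/
theorem le_chord (h : IsConvexProfile φ) {s d t : ℝ} (hs : 0 < s) (hd : 0 < d) (ht : 0 ≤ t) :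
    φ (t + s) ≤ φ t - s / (s + d) * (φ t - φ (t + (s + d))) := by
  have hsd : 0 < s + d := by positivity
  have h1 := h.convex.2 (Set.mem_Ici.2 ht) (Set.mem_Ici.2 (add_nonneg ht hsd.le))
    (show 0 ≤ d / (s + d) by positivity) (show 0 ≤ s / (s + d) by positivity)
    (by field_simp; ring)
  have h2 : (d / (s + d)) • t + (s / (s + d)) • (t + (s + d)) = t + s := by
    simp only [smul_eq_mul]; field_simp; ring
  have h3 : d / (s + d) = 1 - s / (s + d) := by field_simp; ring
  rw [h2, h3] at h1
  simp only [smul_eq_mul] at h1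
  linarith

/-- The interpolation defect between two nodes at distances `s` and `d` is positive. -/
theorem defect_pos (h : IsConvexProfile φ) {s d : ℝ} (hs : 0 < s) (hd : 0 < d) :
    0 < 1 + φ (s + d) - φ s - φ d := by
  -- Supermultiplicativity bounds the defect below by `(1 - φ s) * (1 - φ d)`.
  have := h.mul_le s d hs.le hd.le
  nlinarith [h.lt_one hs, h.lt_one hd, mul_pos (sub_pos.2 (h.lt_one hs)) (sub_pos.2 (h.lt_one hd))]

end IsConvexProfile

/-! ### Two-point interpolation error -/

/-- Lower bound on the two-point interpolation error, in terms of kernel values. -/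
theorem interp_error_lower {P Q R μ T0 T1 T2 w η : ℝ} (hR0 : 0 < R) (hRμ : R ≤ μ)
    (hμ : μ ≤ 1 / 3) (hRP : R < P) (hRQ : R < Q) (hP1 : P < 1) (hQ1 : Q < 1) (hPQ : P * Q ≤ R)
    (hT0 : T0 ≤ μ) (hT12 : T2 ≤ T1) (hPT : T0 * P ≤ T1)
    (hηm : η * (1 + R) = 1 + R - P - Q) (hwm : w * (1 - R ^ 2) = Q - R * P)
    (hw0 : 0 ≤ w) (hw1 : w ≤ 1) (hη : 0 < η) :
    (P - R * w) * T0 + w * T2 - T1 ≤ η * (μ / (1 - μ)) := by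
  -- Here `P, Q, R` stand for `φ s, φ d, φ (s + d)`, and `T0, T1, T2` for `φ t, φ (t + s), φ (t + (s
  -- + d))`. By `hT12` and `hPT` the left side is at most `T0 * (w * (P - R))`, so the point is `w *
  -- (P - R) ≤ η`, which follows from `P * Q ≤ R`.
  have hP0 : 0 < P := hR0.trans hRP
  have hQ0 : 0 < Q := hR0.trans hRQ
  have hμ0 : 0 < μ := hR0.trans_le hRμ
  have a1 : 0 < 1 - P := sub_pos.2 hP1
  have a2 : 0 < 1 - Q := sub_pos.2 hQ1
  have f1 : w * (1 - R) * (1 + R) ≤ Q * (1 - P) * (1 + P) := by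
    have : P * (P * Q) ≤ P * R := mul_le_mul_of_nonneg_left hPQ hP0.le
    linarith
  have f2 : P - R ≤ P * (1 - Q) := by linarith
  have f3 : (1 - P) * (1 - Q) ≤ η * (1 + R) := by linarith
  have f4 : w * (1 - R) * (1 + R) * (P - R) ≤ Q * (1 - P) * (1 + P) * (P * (1 - Q)) :=
    mul_le_mul f1 f2 (by linarith) (by positivity)
  have f5 : (P * Q * (1 + P)) * ((1 - P) * (1 - Q)) ≤ (R * 2) * (η * (1 + R)) :=
    mul_le_mul (mul_le_mul hPQ (by linarith) (by positivity) hR0.le) f3 (by positivity)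
      (by positivity)
  have f6 : w * (P - R) * (1 - R) ≤ 2 * R * η := by
    have : (w * (P - R) * (1 - R)) * (1 + R) ≤ (2 * R * η) * (1 + R) := by linarith
    exact le_of_mul_le_mul_right this (by positivity)
  have f7 : w * (P - R) ≤ η := by
    -- The bound `R ≤ 1 / 3` enters as `2 * R ≤ 1 - R`.
    have b : 2 * R * η ≤ (1 - R) * η := mul_le_mul_of_nonneg_right (by linarith) hη.le
    have : (w * (P - R)) * (1 - R) ≤ η * (1 - R) := by linarith
    exact le_of_mul_le_mul_right this (by linarith)
  have f8 : T0 * (w * (P - R)) ≤ μ * η :=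
    mul_le_mul hT0 f7 (mul_nonneg hw0 (by linarith)) hμ0.le
  have f9 : μ * η ≤ η * (μ / (1 - μ)) := by
    rw [mul_comm]
    refine mul_le_mul_of_nonneg_left ?_ hη.le
    rw [le_div_iff₀ (by linarith)]
    nlinarith
  have f10 : w * T2 ≤ w * T1 := mul_le_mul_of_nonneg_left hT12 hw0
  have f11 : (1 - w) * (T0 * P) ≤ (1 - w) * T1 := mul_le_mul_of_nonneg_left hPT (by linarith)
  linarith

/-- Upper bound on the two-point interpolation error, in terms of kernel values. -/
theorem interp_error_upper {P Q R μ T0 T1 T2 w η σ : ℝ} (hR0 : 0 < R) (hRμ : R ≤ μ)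
    (hμ : μ ≤ 1 / 3)
    (hcQ : Q ≤ 1 - (1 - σ) * (1 - R))
    (hc : T1 ≤ T0 - σ * (T0 - T2)) (hT0 : T0 ≤ μ) (hT2 : 0 < T2) (hT02 : T2 ≤ T0)
    (hηm : η * (1 + R) = 1 + R - P - Q) (hwm : w * (1 - R ^ 2) = Q - R * P) (hη : 0 < η) :
    T1 - (1 - η - w) * T0 - w * T2 ≤ η * (μ / (1 - μ)) := by
  -- The chord bound `hc` leaves `(w - σ) * (T0 - T2) + η * T0`. The chord bound `hcQ` controls `w -
  -- σ` by `η * R / (1 - R)`, and `1 + R / (1 - R) = 1 / (1 - R)`.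
  have hμ0 : 0 < μ := hR0.trans_le hRμ
  have hR1 : 0 < 1 - R := by linarith
  have g0 : (w - σ) * (1 - R) ≤ η * R := by
    have b : R * (1 - P - σ * (1 - R)) ≤ R * (1 + R - P - Q) :=
      mul_le_mul_of_nonneg_left (by linarith) hR0.le
    have : ((w - σ) * (1 - R)) * (1 + R) ≤ (η * R) * (1 + R) := by
      rw [← hηm] at b
      linarith
    exact le_of_mul_le_mul_right this (by positivity)
  have g1 : w - σ ≤ η * (R / (1 - R)) := by
    rw [← mul_div_assoc, le_div_iff₀ hR1]; exact g0
  have a0 : 0 ≤ η * (R / (1 - R)) := by positivity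
  have g2 : (w - σ) * (T0 - T2) ≤ η * (R / (1 - R)) * μ :=
    (mul_le_mul_of_nonneg_right g1 (by linarith)).trans
      (mul_le_mul_of_nonneg_left (by linarith) a0)
  have g3 : η * T0 ≤ η * μ := mul_le_mul_of_nonneg_left hT0 hη.le
  have g4 : η * μ + η * (R / (1 - R)) * μ = η * μ * (1 / (1 - R)) := by
    field_simp; ring
  have g5 : η * μ * (1 / (1 - R)) ≤ η * μ * (1 / (1 - μ)) :=
    mul_le_mul_of_nonneg_left (one_div_le_one_div_of_le (by linarith) (by linarith))
      (by positivity)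
  have g6 : η * (μ / (1 - μ)) = η * μ * (1 / (1 - μ)) := by ring
  rw [g6]
  linarith

namespace IsConvexProfile

variable {φ : ℝ → ℝ}

/-- Error of interpolating the kernel centred at distance `t` beyond a node, at a point at
distances `s` and `d` from two consecutive nodes, by its values at these nodes. -/
theorem abs_interp_error_le (h : IsConvexProfile φ) {s d t r : ℝ} (hs : 0 < s) (hd : 0 < d)
    (hr : 0 < r) (hrsd : r ≤ s + d) (hrt : r ≤ t) (hμ : φ r ≤ 1 / 3) :
    |φ (t + s) - (φ s - φ (s + d) * φ d) / (1 - φ (s + d) ^ 2) * φ t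
      - (φ d - φ (s + d) * φ s) / (1 - φ (s + d) ^ 2) * φ (t + (s + d))|
      ≤ (1 + φ (s + d) - φ s - φ d) / (1 + φ (s + d)) * (φ r / (1 - φ r)) := by
  have hsd : 0 < s + d := by positivity
  have ht : 0 < t := hr.trans_le hrt
  have hη := h.defect_pos hs hd
  have hc := h.le_chord hs hd ht.le
  have hcQ := h.le_chord hd hs le_rfl
  have hPQ := h.mul_le s d hs.le hd.le
  have hPT := h.mul_le t s ht.le hs.le
  have hT01 : φ (t + s) ≤ φ t := h.le_of_le ht.le (by linarith)
  have hT12 : φ (t + (s + d)) ≤ φ (t + s) := h.le_of_le (by linarith) (by linarith)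
  have hT0 : φ t ≤ φ r := h.le_of_le hr.le hrt
  have hR := h.le_of_le hr.le hrsd
  have hP1 := h.lt_one hs
  have hQ1 := h.lt_one hd
  have hP0 := h.pos s
  have hQ0 := h.pos d
  have hR0 := h.pos (s + d)
  have hT2 := h.pos (t + (s + d))
  have hRP : φ (s + d) < φ s := h.anti hs.le hsd.le (by linarith)
  have hRQ : φ (s + d) < φ d := h.anti hd.le hsd.le (by linarith)
  -- The chord over `[0, s + d]`, evaluated at `d`, is expressed with the same ratio `s / (s + d)`
  -- as the chord `hc`.
  rw [add_comm d s, show d / (s + d) = 1 - s / (s + d) by field_simp; ring] at hcQ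
  rw [zero_add, zero_add, h.zero] at hcQ
  have hσ0 : 0 < s / (s + d) := by positivity
  have hσ1 : s / (s + d) < 1 := by rw [div_lt_one hsd]; linarith
  generalize s / (s + d) = σ at *
  generalize φ (t + (s + d)) = T2 at *
  generalize φ (t + s) = T1 at *
  generalize φ t = T0 at *
  generalize φ (s + d) = R at *
  generalize φ s = P at *
  generalize φ d = Q at *
  generalize φ r = μ at *
  clear hs hd hr hrsd hrt hsd ht h
  have hR1 : 0 < 1 - R := by linarith
  have hR2 : 0 < 1 - R ^ 2 := by nlinarith
  obtain ⟨w, hw⟩ : ∃ w, w = (Q - R * P) / (1 - R ^ 2) := ⟨_, rfl⟩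
  obtain ⟨v, hv⟩ : ∃ v, v = (P - R * Q) / (1 - R ^ 2) := ⟨_, rfl⟩
  obtain ⟨η, hηd⟩ : ∃ η, η = (1 + R - P - Q) / (1 + R) := ⟨_, rfl⟩
  rw [← hw, ← hv, ← hηd]
  have hηpos : 0 < η := by rw [hηd]; positivity
  have hηm : η * (1 + R) = 1 + R - P - Q := by rw [hηd]; field_simp
  have hwm : w * (1 - R ^ 2) = Q - R * P := by rw [hw]; field_simp
  have hsum : v + w = 1 - η := by
    rw [hw, hv, hηd]; field_simp; ring
  have hvP : v - P = - R * w := by rw [hw, hv]; field_simp; ring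
  have hw0 : 0 ≤ w := by rw [hw]; apply div_nonneg _ hR2.le; nlinarith
  have hμ0 : 0 < μ := by linarith
  have hw1 : w ≤ 1 := by
    have : 0 ≤ v := by rw [hv]; apply div_nonneg _ hR2.le; nlinarith
    linarith
  have hv' : v = P - R * w := by linarith
  have hv'' : v = 1 - η - w := by linarith
  rw [abs_le]
  constructor
  · have := interp_error_lower hR0 hR hμ hRP hRQ hP1 hQ1 hPQ hT0 hT12 hPT hηm hwm hw0 hw1
      hηpos
    rw [← hv'] at this
    linarith
  · rw [hv'']
    exact interp_error_upper hR0 hR hμ (by linarith) hc hT0 hT2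
      (hT12.trans hT01) hηm hwm hηpos

end IsConvexProfile

/-! ### Interpolation weights on a finite set of nodes -/

namespace IsConvexProfile

variable {φ : ℝ → ℝ}

/-- Interpolation from a single node `α` separating the point `x` from all other nodes. -/
theorem exists_weights_of_end (h : IsConvexProfile φ) {X : Finset ℝ} {r x α : ℝ} (hr : 0 < r)
    (hsep : ∀ u ∈ X, ∀ v ∈ X, u ≠ v → r ≤ |u - v|) (hα : α ∈ X) (hx : x ≠ α)
    (hside : ∀ z ∈ X, |x - z| = |α - z| + |x - α|) :
    ∃ w : ℝ → ℝ, ∃ η > 0, (∀ z ∈ X, 0 ≤ w z) ∧ ∑ z ∈ X, w z = 1 - η ∧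
      (∃ b ∈ X, φ (|x - b|) = ∑ y ∈ X, w y * φ (|y - b|)) ∧
      ∀ z ∈ X, |φ (|x - z|) - ∑ y ∈ X, w y * φ (|y - z|)| ≤ η * (φ r / (1 - φ r)) := by
  have hs : 0 < |x - α| := abs_pos.2 (sub_ne_zero.2 hx)
  have hμ1 := h.lt_one hr
  have hμ0 := h.pos r
  have hP1 := h.lt_one hs
  have hP0 := h.pos |x - α|
  have hsum : ∀ z, ∑ y ∈ X, (Pi.single α (φ (|x - α|)) : ℝ → ℝ) y * φ (|y - z|)
      = φ (|x - α|) * φ (|α - z|) := by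
    intro z
    rw [Finset.sum_eq_single_of_mem α hα]
    · simp
    · intro y _ hy; simp [hy]
  refine ⟨Pi.single α (φ (|x - α|)), 1 - φ (|x - α|), by linarith, ?_, ?_, ⟨α, hα, ?_⟩, ?_⟩
  · intro z _
    by_cases hz : z = α
    · subst hz; simpa using hP0.le
    · simp [hz]
  · rw [Finset.sum_eq_single_of_mem α hα]
    · simp
    · intro y _ hy; simp [hy]
  · rw [hsum]; simp [h.zero]
  · intro z hz
    rw [hsum, hside z hz]
    have hη : 0 ≤ (1 - φ (|x - α|)) * (φ r / (1 - φ r)) :=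
      mul_nonneg (by linarith) (div_nonneg hμ0.le (by linarith))
    by_cases hza : z = α
    · subst hza; simpa [h.zero] using hη
    have ht := hsep α hα z hz (Ne.symm hza)
    -- With `t = |α - z|` and `s = |x - α|`, the error `φ (t + s) - φ s * φ t` is nonnegative by
    -- supermultiplicativity and at most `(1 - φ s) * φ t` by monotonicity.
    have h1 := h.mul_le _ _ (abs_nonneg (α - z)) hs.le
    have h2 := h.le_of_le (abs_nonneg (α - z)) (le_add_of_nonneg_right hs.le)
    have h3 := h.le_of_le hr.le ht
    have h4 : φ r ≤ φ r / (1 - φ r) := by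
      rw [le_div_iff₀ (by linarith)]; nlinarith
    rw [abs_of_nonneg (by linarith)]
    calc _ ≤ (1 - φ (|x - α|)) * φ (|α - z|) := by linarith
      _ ≤ _ := mul_le_mul_of_nonneg_left (h3.trans h4) (by linarith)

/-- Interpolation from the two nodes adjacent to the point `x`. -/
theorem exists_weights_of_gap (h : IsConvexProfile φ) {X : Finset ℝ} {r x α β : ℝ} (hr : 0 < r)
    (hsep : ∀ u ∈ X, ∀ v ∈ X, u ≠ v → r ≤ |u - v|) (hμ : φ r ≤ 1 / 3)
    (hα : α ∈ X) (hβ : β ∈ X) (hαx : α < x) (hxβ : x < β)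
    (hgap : ∀ z ∈ X, z ≤ α ∨ β ≤ z) :
    ∃ w : ℝ → ℝ, ∃ η > 0, (∀ z ∈ X, 0 ≤ w z) ∧ ∑ z ∈ X, w z = 1 - η ∧
      (∃ b ∈ X, φ (|x - b|) = ∑ y ∈ X, w y * φ (|y - b|)) ∧
      ∀ z ∈ X, |φ (|x - z|) - ∑ y ∈ X, w y * φ (|y - z|)| ≤ η * (φ r / (1 - φ r)) := by
  obtain ⟨s, hs⟩ : ∃ s, s = x - α := ⟨_, rfl⟩
  obtain ⟨d, hd⟩ : ∃ d, d = β - x := ⟨_, rfl⟩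
  have hs0 : 0 < s := by linarith
  have hd0 : 0 < d := by linarith
  have hrsd : r ≤ s + d := by
    have := hsep β hβ α hα (by linarith)
    rwa [show β - α = s + d by linarith, abs_of_pos (by linarith)] at this
  have hμ0 := h.pos r
  have hRQ : φ (s + d) < φ d := h.anti hd0.le (by simp; linarith) (by linarith)
  have hRP : φ (s + d) < φ s := h.anti hs0.le (by simp; linarith) (by linarith)
  have hR0 := h.pos (s + d)
  have hR := h.le_of_le hr.le hrsd
  have hP1 := h.lt_one hs0
  have hQ1 := h.lt_one hd0
  have hR2 : 0 < 1 - φ (s + d) ^ 2 := by nlinarith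
  obtain ⟨η, hη⟩ : ∃ η, η = (1 + φ (s + d) - φ s - φ d) / (1 + φ (s + d)) := ⟨_, rfl⟩
  -- The weights solve the 2 × 2 system making interpolation exact at both `α` and `β`; `η` is the
  -- missing mass.
  obtain ⟨u, hu⟩ : ∃ u, u = (φ s - φ (s + d) * φ d) / (1 - φ (s + d) ^ 2) := ⟨_, rfl⟩
  obtain ⟨v, hv⟩ : ∃ v, v = (φ d - φ (s + d) * φ s) / (1 - φ (s + d) ^ 2) := ⟨_, rfl⟩
  have hη0 : 0 < η := by
    have := h.defect_pos hs0 hd0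
    rw [hη]; positivity
  have hu0 : 0 ≤ u := by rw [hu]; exact div_nonneg (by nlinarith) hR2.le
  have hv0 : 0 ≤ v := by rw [hv]; exact div_nonneg (by nlinarith) hR2.le
  have huv : u + v = 1 - η := by
    rw [hu, hv, hη]; field_simp; ring
  have huα : φ s = u + v * φ (s + d) := by
    rw [hu, hv]; field_simp; ring
  have hvβ : φ d = u * φ (s + d) + v := by
    rw [hu, hv]; field_simp; ring
  have hαβ : α ≠ β := by linarith
  have hsum : ∀ g : ℝ → ℝ, ∑ y ∈ X, (if y = α then u else if y = β then v else 0) * g y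
      = u * g α + v * g β := by
    intro g
    have : ∀ y ∈ X, (if y = α then u else if y = β then v else 0) * g y
        = (if y = α then u * g α else 0) + (if y = β then v * g β else 0) := by
      intro y _
      by_cases h1 : y = α
      · subst h1; simp [hαβ]
      · by_cases h2 : y = β
        · subst h2; simp [h1]
        · simp [h1, h2]
    rw [Finset.sum_congr rfl this, Finset.sum_add_distrib]
    simp [hα, hβ]
  have hαerr : φ (|x - α|) = u * φ (|α - α|) + v * φ (|β - α|) := by
    rw [show x - α = s by linarith, show β - α = s + d by linarith, abs_of_pos hs0,
      abs_of_pos (by linarith : 0 < s + d), sub_self, abs_zero, h.zero, mul_one]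
    exact huα
  refine ⟨fun y => if y = α then u else if y = β then v else 0, η, hη0, ?_, ?_, ⟨α, hα, ?_⟩, ?_⟩
  · intro z _
    dsimp only
    split_ifs <;> first | assumption | rfl
  · simpa [huv] using hsum fun _ => 1
  · rw [hsum fun y => φ (|y - α|)]
    exact hαerr
  · intro z hz
    rw [hsum fun y => φ (|y - z|)]
    have hpos : 0 ≤ η * (φ r / (1 - φ r)) :=
      mul_nonneg hη0.le (div_nonneg hμ0.le (by linarith))
    by_cases hzα : z = α
    · rw [hzα, hαerr, sub_self, abs_zero]; exact hpos
    by_cases hzβ : z = β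
    · rw [hzβ, show |x - β| = d by rw [abs_sub_comm, ← hd, abs_of_pos hd0],
        show |α - β| = s + d by rw [abs_sub_comm, abs_of_pos (by linarith)]; linarith, hvβ]
      simpa [h.zero] using hpos
    rcases hgap z hz with hzle | hzle
    · obtain ⟨t, ht⟩ : ∃ t, t = α - z := ⟨_, rfl⟩
      have hrt := hsep α hα z hz (Ne.symm hzα)
      rw [← ht, abs_of_nonneg (by linarith)] at hrt
      have := h.abs_interp_error_le hs0 hd0 hr hrsd hrt hμ
      rw [← hu, ← hv, ← hη] at this
      rw [show x - z = t + s by linarith, show α - z = t by linarith,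
        show β - z = t + (s + d) by linarith, abs_of_nonneg (by linarith : 0 ≤ t),
        abs_of_nonneg (by linarith : 0 ≤ t + s), abs_of_nonneg (by linarith : 0 ≤ t + (s + d)),
        ← sub_sub]
      exact this
    -- Mirror image of the previous case, with `s` and `d` exchanged.
    · obtain ⟨t, ht⟩ : ∃ t, t = z - β := ⟨_, rfl⟩
      have hrt := hsep z hz β hβ hzβ
      rw [← ht, abs_of_nonneg (by linarith)] at hrt
      have := h.abs_interp_error_le hd0 hs0 hr (by linarith) hrt hμ
      rw [add_comm d s, ← hu, ← hv, show 1 + φ (s + d) - φ d - φ s = 1 + φ (s + d) - φ s - φ d by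
        ring, ← hη] at this
      rw [abs_sub_comm x, abs_sub_comm α, abs_sub_comm β, show z - x = t + d by linarith,
        show z - β = t by linarith, show z - α = t + (s + d) by linarith,
        abs_of_nonneg (by linarith : 0 ≤ t), abs_of_nonneg (by linarith : 0 ≤ t + d),
        abs_of_nonneg (by linarith : 0 ≤ t + (s + d)), add_comm (u * _), ← sub_sub]
      exact this

/-- If all nodes lie on one side of `x`, the nearest one suffices; otherwise the two neighbours of
`x` are used. -/
theorem exists_weights (h : IsConvexProfile φ) {X : Finset ℝ} (hX : X.Nonempty) {r x : ℝ}
    (hr : 0 < r) (hsep : ∀ u ∈ X, ∀ v ∈ X, u ≠ v → r ≤ |u - v|)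
    (hμ : (2 * (X.card : ℝ) - 1) * φ r ≤ 1) (hx : x ∉ X) :
    ∃ w : ℝ → ℝ, ∃ η > 0, (∀ z ∈ X, 0 ≤ w z) ∧ ∑ z ∈ X, w z = 1 - η ∧
      (∃ b ∈ X, φ (|x - b|) = ∑ y ∈ X, w y * φ (|y - b|)) ∧
      ∀ z ∈ X, |φ (|x - z|) - ∑ y ∈ X, w y * φ (|y - z|)| ≤ η * (φ r / (1 - φ r)) := by
  classical
  have hne : ∀ z ∈ X, x ≠ z := fun z hz hxz => hx (hxz ▸ hz)
  rcases (X.filter (· < x)).eq_empty_or_nonempty with hL | hL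
  · have hm := X.min'_mem hX
    refine h.exists_weights_of_end hr hsep hm (hne _ hm) fun z hz => ?_
    have h1 := X.min'_le z hz
    have h2 : x ≤ X.min' hX := by
      by_contra hlt
      exact (Finset.filter_eq_empty_iff.1 hL) hm (not_le.1 hlt)
    rw [abs_of_nonpos (by linarith), abs_of_nonpos (by linarith), abs_of_nonpos (by linarith)]
    ring
  rcases (X.filter (x < ·)).eq_empty_or_nonempty with hU | hU
  · have hm := X.max'_mem hX
    refine h.exists_weights_of_end hr hsep hm (hne _ hm) fun z hz => ?_
    have h1 := X.le_max' z hz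
    have h2 : X.max' hX ≤ x := by
      by_contra hlt
      exact (Finset.filter_eq_empty_iff.1 hU) hm (not_le.1 hlt)
    rw [abs_of_nonneg (by linarith), abs_of_nonneg (by linarith), abs_of_nonneg (by linarith)]
    ring
  have hα := Finset.mem_filter.1 ((X.filter (· < x)).max'_mem hL)
  have hβ := Finset.mem_filter.1 ((X.filter (x < ·)).min'_mem hU)
  refine h.exists_weights_of_gap hr hsep ?_ hα.1 hβ.1 hα.2 hβ.2 fun z hz => ?_
  -- Two nodes give `2 * X.card - 1 ≥ 3`, hence `φ r ≤ 1 / 3`.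
  · have hc : 2 ≤ X.card := Finset.one_lt_card.2 ⟨_, hα.1, _, hβ.1, (hα.2.trans hβ.2).ne⟩
    have hc' : (2 : ℝ) ≤ X.card := by exact_mod_cast hc
    nlinarith [h.pos r]
  · rcases lt_or_gt_of_ne (hne z hz) with hlt | hlt
    · exact Or.inr (Finset.min'_le _ _ (Finset.mem_filter.2 ⟨hz, hlt⟩))
    · exact Or.inl (Finset.le_max' _ _ (Finset.mem_filter.2 ⟨hz, hlt⟩))

end IsConvexProfile

/-! ### Maximum principle on the line -/

/-- Diagonal dominance: at an index with the largest coefficient, a kernel with unit diagonal and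
off-diagonal values at most `μ` produces a large value. -/
theorem le_abs_sum_of_coherence {ι : Type*} {X : Finset ι} {K c : ι → ℝ} {μ : ℝ} {m : ι}
    (hm : m ∈ X) (hK : K m = 1) (hKμ : ∀ z ∈ X, z ≠ m → |K z| ≤ μ)
    (hc : ∀ z ∈ X, |c z| ≤ |c m|) :
    |c m| * (1 - ((X.card : ℝ) - 1) * μ) ≤ |∑ z ∈ X, c z * K z| := by
  classical
  have h1 : |∑ z ∈ X.erase m, c z * K z| ≤ ((X.card : ℝ) - 1) * (|c m| * μ) := by
    refine (Finset.abs_sum_le_sum_abs _ _).trans ?_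
    have := Finset.sum_le_card_nsmul (X.erase m) (fun z => |c z * K z|) (|c m| * μ) fun z hz => by
      rw [abs_mul]
      exact mul_le_mul (hc z (Finset.mem_of_mem_erase hz))
        (hKμ z (Finset.mem_of_mem_erase hz) (Finset.ne_of_mem_erase hz)) (abs_nonneg _)
        (abs_nonneg _)
    rwa [nsmul_eq_mul, Finset.card_erase_of_mem hm, Nat.cast_pred (Finset.card_pos.2 ⟨m, hm⟩)]
      at this
  rw [← Finset.add_sum_erase X _ hm, hK, mul_one]
  have h2 := abs_sub_abs_le_abs_sub (c m) (-∑ z ∈ X.erase m, c z * K z)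
  rw [abs_neg, sub_neg_eq_add] at h2
  linarith

/-- A combination of translates of a convex profile centred at well-separated nodes takes its
largest absolute value at the nodes only. -/
theorem IsConvexProfile.exists_node_abs_lt {φ : ℝ → ℝ} (h : IsConvexProfile φ) {X : Finset ℝ}
    {r x : ℝ} (hr : 0 < r) (hsep : ∀ u ∈ X, ∀ v ∈ X, u ≠ v → r ≤ |u - v|)
    (hμ : (2 * (X.card : ℝ) - 1) * φ r ≤ 1) (hx : x ∉ X) (c : ℝ → ℝ)
    (hfx : ∑ z ∈ X, c z * φ (|x - z|) ≠ 0) :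
    ∃ v ∈ X, |∑ z ∈ X, c z * φ (|x - z|)| < |∑ z ∈ X, c z * φ (|v - z|)| := by
  classical
  obtain ⟨z₀, hz₀, hne₀⟩ := Finset.exists_ne_zero_of_sum_ne_zero hfx
  have hX : X.Nonempty := ⟨z₀, hz₀⟩
  obtain ⟨m, hm, hcm⟩ := X.exists_max_image (fun z => |c z|) hX
  have hC : 0 < |c m| := (abs_pos.2 (left_ne_zero_of_mul hne₀)).trans_le (hcm z₀ hz₀)
  by_contra! hcon
  obtain ⟨w, η, hη, hw0, hwsum, ⟨b, hb, heb⟩, hwe⟩ := h.exists_weights hX hr hsep hμ hx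
  set f : ℝ → ℝ := fun y => ∑ z ∈ X, c z * φ (|y - z|) with hf
  set e : ℝ → ℝ := fun z => φ (|x - z|) - ∑ y ∈ X, w y * φ (|y - z|) with he
  have hμ0 := h.pos r
  have hμ1 := h.lt_one hr
  have hfm : |c m| * (1 - ((X.card : ℝ) - 1) * φ r) ≤ |f x| := by
    refine (le_abs_sum_of_coherence hm (by simp [h.zero]) (fun z hz hzm => ?_) hcm).trans
      (hcon m hm)
    rw [abs_of_pos (h.pos _)]
    exact h.le_of_le hr.le (hsep m hm z hz hzm.symm)
  -- Dropping the exact node `b` leaves `X.card - 1` error terms; a full `X.card` would miss the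
  -- threshold.
  have hsplit : f x = ∑ y ∈ X, w y * f y + ∑ z ∈ X.erase b, c z * e z := by
    have h0 : ∑ z ∈ X.erase b, c z * e z = ∑ z ∈ X, c z * e z := by
      rw [← Finset.add_sum_erase X _ hb]
      have : e b = 0 := by simp only [he]; linarith
      rw [this]; ring
    have h1 : ∑ y ∈ X, w y * f y = ∑ z ∈ X, c z * ∑ y ∈ X, w y * φ (|y - z|) := by
      simp only [hf, Finset.mul_sum]
      rw [Finset.sum_comm]
      exact Finset.sum_congr rfl fun z _ => Finset.sum_congr rfl fun y _ => by ring
    rw [h0, h1, ← Finset.sum_add_distrib]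
    exact Finset.sum_congr rfl fun z _ => by simp only [he]; ring
  have hA : |∑ y ∈ X, w y * f y| ≤ (1 - η) * |f x| := by
    rw [← hwsum, Finset.sum_mul]
    refine (Finset.abs_sum_le_sum_abs _ _).trans (Finset.sum_le_sum fun y hy => ?_)
    rw [abs_mul, abs_of_nonneg (hw0 y hy)]
    exact mul_le_mul_of_nonneg_left (hcon y hy) (hw0 y hy)
  have hB : |∑ z ∈ X.erase b, c z * e z|
      ≤ ((X.card : ℝ) - 1) * (|c m| * (η * (φ r / (1 - φ r)))) := by
    refine (Finset.abs_sum_le_sum_abs _ _).trans ?_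
    have := Finset.sum_le_card_nsmul (X.erase b) (fun z => |c z * e z|)
      (|c m| * (η * (φ r / (1 - φ r)))) fun z hz => by
        rw [abs_mul]
        exact mul_le_mul (hcm z (Finset.mem_of_mem_erase hz)) (hwe z (Finset.mem_of_mem_erase hz))
          (abs_nonneg _) (abs_nonneg _)
    rwa [nsmul_eq_mul, Finset.card_erase_of_mem hb, Nat.cast_pred (Finset.card_pos.2 ⟨b, hb⟩)]
      at this
  have htri : |f x| ≤ (1 - η) * |f x| + ((X.card : ℝ) - 1) * (|c m| * (η * (φ r / (1 - φ r)))) := by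
    have := abs_add_le (∑ y ∈ X, w y * f y) (∑ z ∈ X.erase b, c z * e z)
    rw [← hsplit] at this
    linarith
  have hn1 : (1 : ℝ) ≤ X.card := by exact_mod_cast Finset.card_pos.2 hX
  generalize (X.card : ℝ) = n at *
  generalize φ r = μ at *
  have k1 : η * |f x| ≤ η * (|c m| * ((n - 1) * (μ / (1 - μ)))) := by linarith
  have k2 := le_of_mul_le_mul_left k1 hη
  have k3 := le_of_mul_le_mul_left (hfm.trans k2) hC
  have k4 : (n - 1) * (μ / (1 - μ)) * (1 - μ) = (n - 1) * μ := by
    have : 1 - μ ≠ 0 := by linarith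
    field_simp
  have k5 := mul_le_mul_of_nonneg_right k3 (show 0 ≤ 1 - μ by linarith)
  rw [k4] at k5
  -- Expanded, `k5` says `1 + (n - 1) * μ ^ 2 ≤ (2 * n - 1) * μ`, against `hμ` when `n > 1`; for `n
  -- = 1` it contradicts `μ < 1`.
  rcases hn1.eq_or_lt with rfl | hn
  · linarith
  · have : 0 < (n - 1) * μ ^ 2 := mul_pos (by linarith) (by positivity)
    linarith

/-! ### Coordinatewise separated sets -/

section Separated

variable {D : ℕ} {G : Set (Fin D → ℝ)} {r p : ℝ}

/-- `G` is coordinatewise `r`-separated: distinct coordinates of its points are `r` apart. -/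
def CoordSeparated (G : Set (Fin D → ℝ)) (r : ℝ) : Prop :=
  ∀ u ∈ G, ∀ v ∈ G, ∀ d, u d ≠ v d → r ≤ |u d - v d|

theorem CoordSeparated.rpow_le_sum (hG : CoordSeparated G r) (hr : 0 < r) (hp : 0 < p)
    {u v : Fin D → ℝ} (hu : u ∈ G) (hv : v ∈ G) (huv : u ≠ v) :
    r ^ p ≤ ∑ d, |u d - v d| ^ p := by
  obtain ⟨d, hd⟩ := Function.ne_iff.1 huv
  exact (Real.rpow_le_rpow hr.le (hG u hu v hv d hd) hp.le).trans
    (Finset.single_le_sum (f := fun d => |u d - v d| ^ p)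
      (fun e _ => Real.rpow_nonneg (abs_nonneg _) _) (Finset.mem_univ d))

theorem CoordSeparated.rpow_lt_sum_of_two (hG : CoordSeparated G r) (hr : 0 < r) (hp : 0 < p)
    {u v : Fin D → ℝ} (hu : u ∈ G) (hv : v ∈ G) {d e : Fin D} (hde : d ≠ e) (hd : u d ≠ v d)
    (he : u e ≠ v e) : r ^ p < ∑ d, |u d - v d| ^ p := by
  have h1 := Finset.sum_le_sum_of_subset_of_nonneg (f := fun d => |u d - v d| ^ p)
    (Finset.subset_univ {d, e}) fun e _ _ => Real.rpow_nonneg (abs_nonneg _) _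
  rw [Finset.sum_pair hde] at h1
  have h2 := Real.rpow_le_rpow hr.le (hG u hu v hv d hd) hp.le
  have h3 := Real.rpow_le_rpow hr.le (hG u hu v hv e he) hp.le
  have h4 := Real.rpow_pos_of_pos hr p
  linarith

/-- Three distinct points cannot all be at the minimal distance from each other. -/
theorem CoordSeparated.exists_rpow_lt_sum (hG : CoordSeparated G r) (hr : 0 < r) (hp : 0 < p)
    {u v w : Fin D → ℝ} (hu : u ∈ G) (hv : v ∈ G) (hw : w ∈ G) (huv : u ≠ v) (hwu : w ≠ u)
    (hwv : w ≠ v) :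
    r ^ p < ∑ d, |u d - v d| ^ p ∨ r ^ p < ∑ d, |w d - u d| ^ p ∨
      r ^ p < ∑ d, |w d - v d| ^ p := by
  have hone : ∀ x y : Fin D → ℝ, ∀ d, r < |x d - y d| → r ^ p < ∑ d, |x d - y d| ^ p :=
    fun x y d h => (Real.rpow_lt_rpow hr.le h hp).trans_le
      (Finset.single_le_sum (f := fun d => |x d - y d| ^ p)
        (fun e _ => Real.rpow_nonneg (abs_nonneg _) _) (Finset.mem_univ d))
  obtain ⟨d, hd⟩ := Function.ne_iff.1 huv
  by_cases h1 : w d = u d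
  · obtain ⟨e, he⟩ := Function.ne_iff.1 hwu
    have hde : d ≠ e := by rintro rfl; exact he h1
    by_cases h2 : w e = v e
    · exact Or.inl (hG.rpow_lt_sum_of_two hr hp hu hv hde hd (fun h => he (h2.trans h.symm)))
    · exact Or.inr (Or.inr (hG.rpow_lt_sum_of_two hr hp hw hv hde (by rwa [h1]) h2))
  by_cases h3 : w d = v d
  · obtain ⟨e, he⟩ := Function.ne_iff.1 hwv
    have hde : d ≠ e := by rintro rfl; exact he h3
    by_cases h2 : w e = u e
    · exact Or.inl (hG.rpow_lt_sum_of_two hr hp hu hv hde hd (fun h => he (h2.trans h)))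
    · exact Or.inr (Or.inl (hG.rpow_lt_sum_of_two hr hp hw hu hde h1 h2))
  -- The three `d`-coordinates are now distinct reals, so the outer two are at least `2 * r` apart.
  have a1 := hG u hu v hv d hd
  have a2 := hG w hw u hu d h1
  have a3 := hG w hw v hv d h3
  by_contra! hcon
  have b1 := mt (hone u v d) (not_lt.2 hcon.1)
  have b2 := mt (hone w u d) (not_lt.2 hcon.2.1)
  have b3 := mt (hone w v d) (not_lt.2 hcon.2.2)
  rcases abs_cases (u d - v d) with c1 | c1 <;> rcases abs_cases (w d - u d) with c2 | c2 <;>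
    rcases abs_cases (w d - v d) with c3 | c3 <;> linarith

end Separated

/-! ### Maximum principle for the Laplace kernel -/

/-- The kernel `exp (-l ‖θ - θ'‖_p ^ p)` of a generalized Laplace dictionary. -/
noncomputable def laplaceKernel {D : ℕ} (l p : ℝ) (θ θ' : Fin D → ℝ) : ℝ :=
  Real.exp (-l * ∑ d, |θ d - θ' d| ^ p)

section Kernel

variable {D : ℕ} {l p r : ℝ}

theorem laplaceKernel_self (hp : 0 < p) (θ : Fin D → ℝ) : laplaceKernel l p θ θ = 1 := by
  simp [laplaceKernel, Real.zero_rpow hp.ne']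

theorem laplaceKernel_pos (θ θ' : Fin D → ℝ) : 0 < laplaceKernel l p θ θ' := Real.exp_pos _

theorem laplaceKernel_le (hl : 0 < l) {θ θ' : Fin D → ℝ} (h : r ^ p ≤ ∑ d, |θ d - θ' d| ^ p) :
    laplaceKernel l p θ θ' ≤ Real.exp (-l * r ^ p) :=
  Real.exp_le_exp.2 (by nlinarith)

theorem laplaceKernel_lt (hl : 0 < l) {θ θ' : Fin D → ℝ} (h : r ^ p < ∑ d, |θ d - θ' d| ^ p) :
    laplaceKernel l p θ θ' < Real.exp (-l * r ^ p) :=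
  Real.exp_lt_exp.2 (by nlinarith)

theorem laplaceKernel_update (θ s : Fin D → ℝ) (d : Fin D) (x : ℝ) :
    laplaceKernel l p (Function.update θ d x) s =
      Real.exp (-l * ∑ e ∈ Finset.univ.erase d, |θ e - s e| ^ p) *
        Real.exp (-l * |x - s d| ^ p) := by
  rw [laplaceKernel, ← Finset.add_sum_erase _ _ (Finset.mem_univ d), ← Real.exp_add,
    Function.update_self, Finset.sum_congr rfl fun e he => by
      rw [Function.update_of_ne (Finset.ne_of_mem_erase he)]]
  congr 1; ring

/-- This is the one-dimensional maximum principle on the line through `θ` in direction `d`.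
Projecting `S` can only merge nodes, so separation and threshold persist. -/
theorem exists_abs_lt_update (hl : 0 < l) (hp : 0 < p) (hp1 : p ≤ 1)
    {S : Finset (Fin D → ℝ)} (hr : 0 < r) (hS : CoordSeparated (S : Set (Fin D → ℝ)) r)
    (hμ : (2 * (S.card : ℝ) - 1) * Real.exp (-l * r ^ p) ≤ 1) (c : (Fin D → ℝ) → ℝ)
    {θ : Fin D → ℝ} {d : Fin D} (hd : ∀ s ∈ S, θ d ≠ s d)
    (hf : ∑ s ∈ S, c s * laplaceKernel l p θ s ≠ 0) :
    ∃ v ∈ S, |∑ s ∈ S, c s * laplaceKernel l p θ s| <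
      |∑ s ∈ S, c s * laplaceKernel l p (Function.update θ d (v d)) s| := by
  classical
  set X : Finset ℝ := S.image fun s => s d with hX
  -- Points of `S` sharing a `d`-coordinate become one node; the factors from the other coordinates
  -- are absorbed into its coefficient.
  set C : ℝ → ℝ := fun v => ∑ s ∈ S with s d = v,
    c s * Real.exp (-l * ∑ e ∈ Finset.univ.erase d, |θ e - s e| ^ p) with hC
  have key : ∀ x, ∑ s ∈ S, c s * laplaceKernel l p (Function.update θ d x) s
      = ∑ v ∈ X, C v * (fun t : ℝ => Real.exp (-l * t ^ p)) (|x - v|) := by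
    intro x
    rw [← Finset.sum_fiberwise_of_maps_to
      (fun s hs => Finset.mem_image_of_mem (fun s : Fin D → ℝ => s d) hs)]
    refine Finset.sum_congr rfl fun v _ => ?_
    rw [hC, Finset.sum_mul]
    refine Finset.sum_congr rfl fun s hs => ?_
    rw [laplaceKernel_update, (Finset.mem_filter.1 hs).2, mul_assoc]
  have hθ := key (θ d)
  rw [Function.update_eq_self] at hθ
  have hcard : (X.card : ℝ) ≤ S.card := by exact_mod_cast Finset.card_image_le
  have hsep : ∀ u ∈ X, ∀ v ∈ X, u ≠ v → r ≤ |u - v| := by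
    intro u hu v hv huv
    obtain ⟨s, hs, rfl⟩ := Finset.mem_image.1 hu
    obtain ⟨s', hs', rfl⟩ := Finset.mem_image.1 hv
    exact hS s hs s' hs' d huv
  have hμX : (2 * (X.card : ℝ) - 1) * Real.exp (-l * r ^ p) ≤ 1 :=
    le_trans (mul_le_mul_of_nonneg_right (by linarith) (Real.exp_pos _).le) hμ
  have hmem : θ d ∉ X := by
    intro hmem
    obtain ⟨s, hs, hsd⟩ := Finset.mem_image.1 hmem
    exact hd s hs hsd.symm
  rw [hθ] at hf
  obtain ⟨v, hv, hlt⟩ :=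
    (IsConvexProfile.exp_rpow hl hp hp1).exists_node_abs_lt hr hsep hμX hmem C hf
  obtain ⟨s, hs, rfl⟩ := Finset.mem_image.1 hv
  refine ⟨s, hs, ?_⟩
  rw [hθ, key]
  exact hlt

/-- Diagonal dominance at a largest coefficient. This also yields linear independence of the atoms.
-/
theorem exists_abs_sum_pos (hl : 0 < l) (hp : 0 < p)
    {S : Finset (Fin D → ℝ)} (hr : 0 < r) (hS : CoordSeparated (S : Set (Fin D → ℝ)) r)
    (hμ : (2 * (S.card : ℝ) - 1) * Real.exp (-l * r ^ p) ≤ 1) {c : (Fin D → ℝ) → ℝ}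
    (hc : ∃ s ∈ S, c s ≠ 0) : ∃ s ∈ S, 0 < |∑ z ∈ S, c z * laplaceKernel l p s z| := by
  obtain ⟨z₀, hz₀, hne₀⟩ := hc
  obtain ⟨m, hm, hcm⟩ := S.exists_max_image (fun z => |c z|) ⟨z₀, hz₀⟩
  have hC : 0 < |c m| := (abs_pos.2 hne₀).trans_le (hcm z₀ hz₀)
  refine ⟨m, hm, lt_of_lt_of_le (mul_pos hC ?_) (le_abs_sum_of_coherence hm
    (μ := Real.exp (-l * r ^ p)) (laplaceKernel_self hp m) (fun z hz hzm => ?_) hcm)⟩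
  · have hn : (1 : ℝ) ≤ S.card := by exact_mod_cast Finset.card_pos.2 ⟨m, hm⟩
    have := Real.exp_pos (-l * r ^ p)
    nlinarith
  · rw [abs_of_pos (laplaceKernel_pos _ _)]
    exact laplaceKernel_le hl (hS.rpow_le_sum hr hp hm hz hzm.symm)

/-- The maximum is compared with the value at a point `m` of largest coefficient; only mutual
distances within `G` matter. -/
theorem exists_abs_lt_of_mem_grid (hl : 0 < l) (hp : 0 < p)
    {S : Finset (Fin D → ℝ)} {G : Set (Fin D → ℝ)} (hSG : (S : Set (Fin D → ℝ)) ⊆ G) (hr : 0 < r)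
    (hG : CoordSeparated G r)
    (hμ : (2 * (S.card : ℝ) - 1) * Real.exp (-l * r ^ p) ≤ 1) {c : (Fin D → ℝ) → ℝ}
    (hc : ∃ s ∈ S, c s ≠ 0) {θ : Fin D → ℝ} (hθG : θ ∈ G) (hθ : θ ∉ S) :
    ∃ s ∈ S, |∑ z ∈ S, c z * laplaceKernel l p θ z| < |∑ z ∈ S, c z * laplaceKernel l p s z| := by
  classical
  obtain ⟨z₀, hz₀, hne₀⟩ := hc
  obtain ⟨m, hm, hcm⟩ := S.exists_max_image (fun z => |c z|) ⟨z₀, hz₀⟩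
  have hC : 0 < |c m| := (abs_pos.2 hne₀).trans_le (hcm z₀ hz₀)
  refine ⟨m, hm, ?_⟩
  have hK : ∀ u ∈ G, ∀ v ∈ G, u ≠ v → laplaceKernel l p u v ≤ Real.exp (-l * r ^ p) :=
    fun u hu v hv huv => laplaceKernel_le hl (hG.rpow_le_sum hr hp hu hv huv)
  have hθne : ∀ z ∈ S, θ ≠ z := fun z hz h => hθ (h ▸ hz)
  have hμ0 := Real.exp_pos (-l * r ^ p)
  have hμ1 : Real.exp (-l * r ^ p) < 1 :=
    Real.exp_lt_one_iff.2 (by have := Real.rpow_pos_of_pos hr p; nlinarith)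
  have h1 : |∑ z ∈ S, c z * laplaceKernel l p θ z|
      ≤ |c m| * laplaceKernel l p θ m + ∑ z ∈ S.erase m, |c z| * laplaceKernel l p θ z := by
    rw [Finset.add_sum_erase S (fun z => |c z| * laplaceKernel l p θ z) hm]
    refine (Finset.abs_sum_le_sum_abs _ _).trans (Finset.sum_le_sum fun z _ => ?_)
    rw [abs_mul, abs_of_pos (laplaceKernel_pos _ _)]
  have h2 : |c m| - ∑ z ∈ S.erase m, |c z| * laplaceKernel l p m z
      ≤ |∑ z ∈ S, c z * laplaceKernel l p m z| := by
    rw [← Finset.add_sum_erase S _ hm, laplaceKernel_self hp, mul_one]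
    have a1 := abs_sub_abs_le_abs_sub (c m) (-∑ z ∈ S.erase m, c z * laplaceKernel l p m z)
    rw [abs_neg, sub_neg_eq_add] at a1
    have a2 : |∑ z ∈ S.erase m, c z * laplaceKernel l p m z|
        ≤ ∑ z ∈ S.erase m, |c z| * laplaceKernel l p m z := by
      refine (Finset.abs_sum_le_sum_abs _ _).trans (Finset.sum_le_sum fun z _ => ?_)
      rw [abs_mul, abs_of_pos (laplaceKernel_pos _ _)]
    linarith
  -- Here `1 + 2 * (S.card - 1)` kernel values appear, each at most `exp (-l * r ^ p)`, so `hμ`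
  -- gives `≤`; strictness must come from elsewhere.
  suffices h3 : |c m| * laplaceKernel l p θ m +
      ∑ z ∈ S.erase m, |c z| * (laplaceKernel l p θ z + laplaceKernel l p m z) < |c m| by
    simp only [mul_add, Finset.sum_add_distrib] at h3
    linarith
  have hθm := hK θ hθG m (hSG hm) (hθne m hm)
  rcases (S.erase m).eq_empty_or_nonempty with he | ⟨j, hj⟩
  · rw [he, Finset.sum_empty, add_zero]
    have := mul_le_mul_of_nonneg_left hθm hC.le
    nlinarith
  · obtain ⟨hjm, hjS⟩ := Finset.mem_erase.1 hj
    rw [← Finset.add_sum_erase _ _ hj]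
    have hθj := hK θ hθG j (hSG hjS) (hθne j hjS)
    have hmj := hK m (hSG hm) j (hSG hjS) hjm.symm
    -- Among `θ, m, j` some distance is not minimal, which supplies strictness.
    have hlt : laplaceKernel l p θ m + (laplaceKernel l p θ j + laplaceKernel l p m j)
        < 3 * Real.exp (-l * r ^ p) := by
      rcases hG.exists_rpow_lt_sum hr hp (hSG hm) (hSG hjS) hθG hjm.symm (hθne m hm)
        (hθne j hjS) with h | h | h <;> have := laplaceKernel_lt hl h <;> linarith
    have hrest := Finset.sum_le_card_nsmul ((S.erase m).erase j)
      (fun z => |c z| * (laplaceKernel l p θ z + laplaceKernel l p m z))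
      (|c m| * (2 * Real.exp (-l * r ^ p))) fun z hz => by
        have hz' := Finset.mem_of_mem_erase hz
        have hzS := Finset.mem_of_mem_erase hz'
        have b1 := hK θ hθG z (hSG hzS) (hθne z hzS)
        have b2 := hK m (hSG hm) z (hSG hzS) (Finset.ne_of_mem_erase hz').symm
        exact mul_le_mul (hcm z hzS) (by linarith)
          (add_pos (laplaceKernel_pos _ _) (laplaceKernel_pos _ _)).le hC.le
    have hcard : (((S.erase m).erase j).card : ℝ) = S.card - 2 := by
      rw [Finset.card_erase_of_mem hj, Nat.cast_pred (Finset.card_pos.2 ⟨j, hj⟩),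
        Finset.card_erase_of_mem hm, Nat.cast_pred (Finset.card_pos.2 ⟨m, hm⟩)]
      ring
    rw [nsmul_eq_mul, hcard] at hrest
    have hj1 : |c j| * (laplaceKernel l p θ j + laplaceKernel l p m j)
        ≤ |c m| * (laplaceKernel l p θ j + laplaceKernel l p m j) :=
      mul_le_mul_of_nonneg_right (hcm j hjS)
        (add_pos (laplaceKernel_pos _ _) (laplaceKernel_pos _ _)).le
    have h5 := mul_lt_mul_of_pos_left hlt hC
    have h6 := mul_le_mul_of_nonneg_left hμ hC.le
    linarith

/-- Exact recovery condition: a nontrivial combination of kernels centred at the points of `S`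
takes its largest absolute value on `S` only. -/
theorem exists_abs_lt_of_notMem (hl : 0 < l) (hp : 0 < p) (hp1 : p ≤ 1)
    {S : Finset (Fin D → ℝ)} (hr : 0 < r) (hS : CoordSeparated (S : Set (Fin D → ℝ)) r)
    (hμ : (2 * (S.card : ℝ) - 1) * Real.exp (-l * r ^ p) ≤ 1) {c : (Fin D → ℝ) → ℝ}
    (hc : ∃ s ∈ S, c s ≠ 0) {θ : Fin D → ℝ} (hθ : θ ∉ S) :
    ∃ s ∈ S, |∑ z ∈ S, c z * laplaceKernel l p θ z| < |∑ z ∈ S, c z * laplaceKernel l p s z| := by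
  classical
  by_cases hf : ∑ z ∈ S, c z * laplaceKernel l p θ z = 0
  · rw [hf, abs_zero]
    exact exists_abs_sum_pos hl hp hr hS hμ hc
  -- Induction on the number of coordinates of `θ` off the grid; the strict increase keeps the sum
  -- nonzero along the way.
  obtain ⟨n, hn⟩ : ∃ n, n = (Finset.univ.filter fun d => ∀ s ∈ S, θ d ≠ s d).card := ⟨_, rfl⟩
  induction n using Nat.strong_induction_on generalizing θ with
  | _ n ih =>
    by_cases hgrid : ∀ d, ∃ s ∈ S, θ d = s d
    · refine exists_abs_lt_of_mem_grid hl hp (G := {u | ∀ d, ∃ s ∈ S, u d = s d})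
        (fun s hs d => ⟨s, hs, rfl⟩) hr ?_ hμ hc hgrid hθ
      intro u hu v hv d huv
      obtain ⟨s, hs, hus⟩ := hu d
      obtain ⟨s', hs', hvs⟩ := hv d
      rw [hus, hvs] at huv ⊢
      exact hS s hs s' hs' d huv
    push Not at hgrid
    obtain ⟨d, hd⟩ := hgrid
    obtain ⟨v, hv, hlt⟩ := exists_abs_lt_update hl hp hp1 hr hS hμ c hd hf
    by_cases hmem : Function.update θ d (v d) ∈ S
    · exact ⟨_, hmem, hlt⟩
    have hlt_card : (Finset.univ.filter fun e => ∀ s ∈ S, Function.update θ d (v d) e ≠ s e).card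
        < n := by
      rw [hn]
      refine Finset.card_lt_card (Finset.ssubset_iff_of_subset ?_ |>.2
        ⟨d, Finset.mem_filter.2 ⟨Finset.mem_univ _, hd⟩, ?_⟩)
      · intro e he
        have he' := (Finset.mem_filter.1 he).2
        have hed : e ≠ d := by
          rintro rfl
          exact he' v hv (by simp)
        simpa [hed] using he'
      · simp only [Finset.mem_filter, Finset.mem_univ, true_and, Function.update_self]
        exact fun h => h v hv rfl
    obtain ⟨s, hs, hlt'⟩ := ih _ hlt_card hmem (abs_pos.1 ((abs_nonneg _).trans_lt hlt)) rfl
    exact ⟨s, hs, hlt.trans hlt'⟩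

end Kernel

/-! ### OMP under the exact recovery condition -/

section OMP

variable {Θ H : Type*} [NormedAddCommGroup H] [InnerProductSpace ℝ H] {a : Θ → H} {y : H}

/-- Least-squares coefficients exist. -/
theorem exists_ompResidual_minimizer (a : Θ → H) (y : H) {t : ℕ} (θ : Fin t → Θ) :
    ∃ c : Fin t → ℝ, ∀ d, ‖ompResidual a y θ c‖ ≤ ‖ompResidual a y θ d‖ := by
  set K := Submodule.span ℝ (Set.range fun i => a (θ i)) with hK
  have : FiniteDimensional ℝ K := FiniteDimensional.span_of_finite ℝ (Set.finite_range _)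
  have hcomplete : IsComplete (K : Set H) :=
    completeSpace_coe_iff_isComplete.1 (FiniteDimensional.complete ℝ K)
  obtain ⟨v, hv, hmin⟩ := K.exists_norm_eq_iInf_of_complete_subspace hcomplete y
  obtain ⟨c, rfl⟩ := (Submodule.mem_span_range_iff_exists_fun ℝ).1 hv
  refine ⟨c, fun d => ?_⟩
  have hd : ∑ i, d i • a (θ i) ∈ K := (Submodule.mem_span_range_iff_exists_fun ℝ).2 ⟨d, rfl⟩
  rw [ompResidual, hmin]
  exact ciInf_le (f := fun w : (K : Set H) => ‖y - w‖)
    ⟨0, Set.forall_mem_range.2 fun _ => norm_nonneg _⟩ ⟨_, hd⟩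

/-- Least-squares residuals are orthogonal to the selected unit-norm atoms. -/
theorem inner_ompResidual_eq_zero {t : ℕ} {θ : Fin t → Θ} {c : Fin t → ℝ} (ha : ∀ ϑ, ‖a ϑ‖ = 1)
    (hc : ∀ d, ‖ompResidual a y θ c‖ ≤ ‖ompResidual a y θ d‖) (i : Fin t) :
    ⟪a (θ i), ompResidual a y θ c⟫ = 0 := by
  set r := ompResidual a y θ c with hr
  set ε := ⟪a (θ i), r⟫ with hε
  -- Shifting the `i`-th coefficient by `ε` lowers the squared norm by `ε ^ 2`, so minimality forces
  -- `ε = 0`.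
  have h1 : ompResidual a y θ (c + Pi.single i ε) = r - ε • a (θ i) := by
    rw [hr, ompResidual, ompResidual]
    simp only [Pi.add_apply, add_smul, Finset.sum_add_distrib]
    rw [Finset.sum_eq_single_of_mem (f := fun j => (Pi.single i ε : Fin t → ℝ) j • a (θ j)) i
      (Finset.mem_univ i) fun j _ hj => by simp [hj]]
    simp [sub_sub]
  have h2 := hc (c + Pi.single i ε)
  rw [h1] at h2
  have h3 : ‖r - ε • a (θ i)‖ ^ 2 = ‖r‖ ^ 2 - ε ^ 2 := by
    rw [norm_sub_sq_real, inner_smul_right, real_inner_comm, ← hε, norm_smul, ha, mul_one,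
      Real.norm_eq_abs, sq_abs]
    ring
  have h4 := pow_le_pow_left₀ (norm_nonneg _) h2 2
  rw [h3] at h4
  exact pow_eq_zero_iff two_ne_zero |>.1 (le_antisymm (by linarith) (sq_nonneg ε))

/-- Keeps the residual in the span of the atoms of `S`, where the exact recovery condition applies.
-/
theorem ompResidual_sum_eq [DecidableEq Θ] {S : Finset Θ} (c : Θ → ℝ) {t : ℕ} {θ : Fin t → Θ}
    (ĉ : Fin t → ℝ) (hθ : ∀ i, θ i ∈ S) :
    ompResidual a (∑ ϑ ∈ S, c ϑ • a ϑ) θ ĉ =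
      ∑ ϑ ∈ S, (c ϑ - ∑ i, if θ i = ϑ then ĉ i else 0) • a ϑ := by
  simp only [ompResidual, sub_smul, Finset.sum_sub_distrib, Finset.sum_smul]
  rw [Finset.sum_comm]
  congr 1
  refine Finset.sum_congr rfl fun i _ => ?_
  rw [Finset.sum_eq_single_of_mem (θ i) (hθ i)]
  · simp
  · intro ϑ _ hϑ
    simp [hϑ.symm]

/-- If the atoms indexed by `S` are linearly independent and satisfy the exact recovery condition,
then OMP recovers `S`. -/
theorem ompExactRecovery_of_forall_exists_lt {S : Finset Θ} (ha : ∀ ϑ, ‖a ϑ‖ = 1)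
    (hlin : ∀ e : Θ → ℝ, ∑ ϑ ∈ S, e ϑ • a ϑ = 0 → ∀ ϑ ∈ S, e ϑ = 0)
    (herc : ∀ e : Θ → ℝ, (∃ ϑ ∈ S, e ϑ ≠ 0) → ∀ ϑ, ϑ ∉ S → ∃ s ∈ S,
      |⟪a ϑ, ∑ z ∈ S, e z • a z⟫| < |⟪a s, ∑ z ∈ S, e z • a z⟫|) :
    OMPExactRecovery a S := by
  classical
  intro c hc
  have hres : ∀ (t : ℕ) (θ : Fin t → Θ) (ĉ : Fin t → ℝ), (∀ i, θ i ∈ S) →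
      ompResidual a (∑ ϑ ∈ S, c ϑ • a ϑ) θ ĉ ≠ 0 → ∀ ϑ, ϑ ∉ S → ∃ s ∈ S,
        |⟪a ϑ, ompResidual a (∑ ϑ ∈ S, c ϑ • a ϑ) θ ĉ⟫| <
          |⟪a s, ompResidual a (∑ ϑ ∈ S, c ϑ • a ϑ) θ ĉ⟫| := by
    intro t θ ĉ hθ hr
    rw [ompResidual_sum_eq c ĉ hθ] at hr ⊢
    refine herc _ ?_
    by_contra! h0
    exact hr (Finset.sum_eq_zero fun s hs => by rw [h0 s hs, zero_smul])
  have hinv : ∀ (t : ℕ) (θ : Fin t → Θ) (ĉ : Fin t → ℝ),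
      OMPReach a (∑ ϑ ∈ S, c ϑ • a ϑ) t θ ĉ →
      (∀ i, θ i ∈ S) ∧ Function.Injective θ ∧
        ∀ i, ⟪a (θ i), ompResidual a (∑ ϑ ∈ S, c ϑ • a ϑ) θ ĉ⟫ = 0 := by
    intro t θ ĉ h
    induction h with
    | init θ ĉ => exact ⟨fun i => i.elim0, fun i => i.elim0, fun i => i.elim0⟩
    | @step t θ ĉ h hr θnew hsel c' hls ih =>
      obtain ⟨hmem, hinj, horth⟩ := ih
      have hnew : θnew ∈ S := by
        by_contra hnot
        obtain ⟨s, _, hlt⟩ := hres t θ ĉ hmem hr θnew hnot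
        exact not_le.2 hlt (hsel s)
      -- Reselection would make the maximal correlation zero; the residual, lying in the span of the
      -- atoms, would be orthogonal to itself.
      have hnotin : θnew ∉ Set.range θ := by
        rintro ⟨i, rfl⟩
        have hz : ∀ ϑ, ⟪a ϑ, ompResidual a (∑ ϑ ∈ S, c ϑ • a ϑ) θ ĉ⟫ = 0 := fun ϑ => by
          have := hsel ϑ
          rwa [horth i, abs_zero, abs_nonpos_iff] at this
        apply hr
        rw [← inner_self_eq_zero (𝕜 := ℝ)]
        nth_rw 1 [ompResidual_sum_eq c ĉ hmem]
        rw [sum_inner]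
        exact Finset.sum_eq_zero fun ϑ _ => by rw [inner_smul_left, hz, mul_zero]
      refine ⟨fun i => ?_, Fin.snoc_injective_iff.2 ⟨hinj, hnotin⟩,
        inner_ompResidual_eq_zero ha hls⟩
      induction i using Fin.lastCases with
      | last => rwa [Fin.snoc_last]
      | cast i => rw [Fin.snoc_castSucc]; exact hmem i
  refine ⟨fun t θ ĉ h hr => ?_, fun t θ ĉ h => ?_, fun t θ ĉ h => ?_⟩
  · have hmem := (hinv t θ ĉ h).1
    have hS : S.Nonempty := by
      by_contra hS
      rw [Finset.not_nonempty_iff_eq_empty] at hS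
      subst hS
      apply hr
      rw [ompResidual_sum_eq c ĉ hmem, Finset.sum_empty]
    obtain ⟨θnew, hnew, hmax⟩ := S.exists_max_image
      (fun ϑ => |⟪a ϑ, ompResidual a (∑ ϑ ∈ S, c ϑ • a ϑ) θ ĉ⟫|) hS
    obtain ⟨c', hc'⟩ := exists_ompResidual_minimizer a (∑ ϑ ∈ S, c ϑ • a ϑ)
      (Fin.snoc θ θnew : Fin (t + 1) → Θ)
    refine ⟨θnew, c', h.step hr θnew (fun ϑ => ?_) c' hc'⟩
    by_cases hϑ : ϑ ∈ S
    · exact hmax ϑ hϑ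
    · obtain ⟨s, hs, hlt⟩ := hres t θ ĉ hmem hr ϑ hϑ
      exact hlt.le.trans (hmax s hs)
  · obtain ⟨hmem, hinj, _⟩ := hinv t θ ĉ h
    have := Finset.card_le_card_of_injOn (s := Finset.univ) (t := S) θ (fun i _ => hmem i)
      hinj.injOn
    simpa using this
  · obtain ⟨hmem, hinj, _⟩ := hinv t θ ĉ h.1
    have h0 := h.2
    rw [ompResidual_sum_eq c ĉ hmem] at h0
    have hcoef := hlin _ h0
    have hrange : Set.range θ = (S : Set Θ) := by
      refine Set.Subset.antisymm (Set.range_subset_iff.2 hmem) fun s hs => ?_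
      by_contra hnot
      have h1 := hcoef s hs
      rw [Finset.sum_eq_zero fun i _ => if_neg fun hi => hnot ⟨i, hi⟩, sub_zero] at h1
      exact hc s hs h1
    refine ⟨?_, hrange, fun i => ?_⟩
    · rw [← Set.ncard_coe_finset, ← hrange, ← Set.image_univ, Set.ncard_image_of_injective _ hinj]
      simp
    · have h1 := hcoef (θ i) (hmem i)
      rw [Finset.sum_eq_single_of_mem i (Finset.mem_univ i)
        fun j _ hj => if_neg fun hi => hj (hinj hi), if_pos rfl] at h1
      linarith

end OMP

/-! ### Generalized Laplace dictionaries -/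

section Dictionary

variable {D : ℕ} {H : Type*} [NormedAddCommGroup H] [InnerProductSpace ℝ H]
  {a : (Fin D → ℝ) → H} {l p : ℝ}

theorem IsGeneralizedLaplaceDictionary.inner_sum (ha : IsGeneralizedLaplaceDictionary a l p)
    (S : Finset (Fin D → ℝ)) (e : (Fin D → ℝ) → ℝ) (θ : Fin D → ℝ) :
    ⟪a θ, ∑ z ∈ S, e z • a z⟫ = ∑ z ∈ S, e z * laplaceKernel l p θ z := by
  rw [_root_.inner_sum]
  exact Finset.sum_congr rfl fun z _ => by rw [inner_smul_right, ha.inner_eq, laplaceKernel]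

/-- OMP recovers coordinatewise separated supports in generalized Laplace dictionaries. -/
theorem IsGeneralizedLaplaceDictionary.ompExactRecovery
    (ha : IsGeneralizedLaplaceDictionary a l p) {S : Finset (Fin D → ℝ)} {r : ℝ} (hr : 0 < r)
    (hS : CoordSeparated (S : Set (Fin D → ℝ)) r)
    (hμ : (2 * (S.card : ℝ) - 1) * Real.exp (-l * r ^ p) ≤ 1) : OMPExactRecovery a S := by
  refine ompExactRecovery_of_forall_exists_lt (fun ϑ => ?_) (fun e he => ?_)
    fun e he ϑ hϑ => ?_
  · have h1 : ⟪a ϑ, a ϑ⟫ = 1 := by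
      rw [ha.inner_eq]; exact laplaceKernel_self ha.p_pos ϑ
    rw [real_inner_self_eq_norm_sq] at h1
    exact (pow_eq_one_iff_of_nonneg (norm_nonneg _) two_ne_zero).1 h1
  · by_contra! hne
    obtain ⟨s, _, hpos⟩ := exists_abs_sum_pos ha.l_pos ha.p_pos hr hS hμ hne
    rw [← ha.inner_sum, he, inner_zero_right, abs_zero] at hpos
    exact lt_irrefl _ hpos
  · simp only [ha.inner_sum]
    exact exists_abs_lt_of_notMem ha.l_pos ha.p_pos ha.p_le_one hr hS hμ he hϑ

end Dictionary

theorem mainTheorem5 {D : ℕ} {H : Type*} [NormedAddCommGroup H] [InnerProductSpace ℝ H]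
    [CompleteSpace H] (a : (Fin D → ℝ) → H) (l p : ℝ)
    (ha : IsGeneralizedLaplaceDictionary a l p)
    (Sstar : Finset (Fin D → ℝ)) (hne : Sstar.Nonempty)
    (hsep : Real.log (2 * (Sstar.card : ℝ) - 1) / l ≤ minCoordSeparation Sstar ^ p) :
    ∀ S ⊆ Sstar, OMPExactRecovery a S := by
  intro S hS
  have hl := ha.l_pos
  have hp := ha.p_pos
  have hcard : (S.card : ℝ) ≤ Sstar.card := by exact_mod_cast Finset.card_le_card hS
  rcases (Nat.succ_le_of_lt (Finset.card_pos.2 hne)).eq_or_lt with h1 | h1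
  · have hc1 : Sstar.card = 1 := h1.symm
    -- With a single point no separation constraint exists, so any positive radius serves; `1` is
    -- taken.
    refine ha.ompExactRecovery one_pos (fun u hu v hv d huv => ?_) ?_
    · exact absurd (by rw [Finset.card_le_one.1 hc1.le u (hS hu) v (hS hv)]) huv
    · rw [hc1, Nat.cast_one] at hcard
      have : Real.exp (-l * 1 ^ p) ≤ 1 := Real.exp_le_one_iff.2 (by simp [hl.le])
      have := Real.exp_pos (-l * 1 ^ p)
      nlinarith
  · have hk : (2 : ℝ) ≤ Sstar.card := by exact_mod_cast h1
    have hlower : ∀ x ∈ coordSeparations Sstar, 0 ≤ x := by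
      rintro x ⟨d, u, _, v, _, _, rfl⟩
      exact abs_nonneg _
    have hΔ0 : 0 ≤ minCoordSeparation Sstar := Real.sInf_nonneg hlower
    have hlog : 0 < Real.log (2 * (Sstar.card : ℝ) - 1) := Real.log_pos (by linarith)
    -- For at least two points the logarithm is positive, whereas `0 ^ p = 0`, so `hsep` excludes
    -- separation zero.
    have hΔ : 0 < minCoordSeparation Sstar := by
      refine lt_of_le_of_ne hΔ0 fun h => ?_
      rw [← h, Real.zero_rpow hp.ne'] at hsep
      exact absurd hsep (not_le.2 (div_pos hlog hl))
    refine ha.ompExactRecovery hΔ (fun u hu v hv d huv => ?_) ?_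
    · exact csInf_le ⟨0, hlower⟩ ⟨d, u, hS hu, v, hS hv, huv, rfl⟩
    · rw [div_le_iff₀ hl] at hsep
      have h2 : Real.exp (-l * minCoordSeparation Sstar ^ p) ≤ (2 * (Sstar.card : ℝ) - 1)⁻¹ := by
        rw [← Real.exp_log (show 0 < 2 * (Sstar.card : ℝ) - 1 by linarith), ← Real.exp_neg]
        refine Real.exp_le_exp.2 ?_
        linarith
      calc _ ≤ (2 * (Sstar.card : ℝ) - 1) * Real.exp (-l * minCoordSeparation Sstar ^ p) :=
            mul_le_mul_of_nonneg_right (by linarith) (Real.exp_pos _).le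
        _ ≤ (2 * (Sstar.card : ℝ) - 1) * (2 * (Sstar.card : ℝ) - 1)⁻¹ :=
            mul_le_mul_of_nonneg_left h2 (by linarith)
        _ = 1 := mul_inv_cancel₀ (by linarith)
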